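/- Let $D=(d_1,\dots,d_n)$ be the degree sequence of a finite tree, ordered so that $d_1\ge d_2\ge\dots\ge d_n$ (two sequences that differ only in order are regarded as the same). The greedy tree $\mathcal G(D)$ is the graph on the vertices $u_1,\dots,u_n$ built as follows: start with the root $u_1$ alone; then let $u_1,u_2,u_3,\dots$ take turns in this order, where in its turn $u_1$ is joined to the next $d_1$ vertices that have not been used so far, and $u_i$ with $i\ge 2$ is joined to the next $d_i-1$ vertices that have not been used so far (vertices being used in the order $u_2,u_3,\dots,u_n$). For a finite tree $T$ let $\eta(T)$ be the number of subtrees of $T$, that is, the number of nonempty sets of vertices of $T$ that induce a connected subgraph. Then $\mathcal G(D)$ is a tree with degree sequence $D$, and it is, up to isomorphism, the unique tree that maximises the number of subtrees among all trees with degree sequence $D$: for every tree $T$ with degree sequence $D$ we have $\eta(T)\le\eta(\mathcal G(D))$, with equality if and only if $T$ is isomorphic to $\mathcal G(D)$. -/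

import Mathlib

/-- The degree sequence of a finite graph: the degrees of its vertices, with multiplicity and
irrespective of order. -/
noncomputable def degreeSequence {V : Type*} [Fintype V] (G : SimpleGraph V) : Multiset ℕ :=
  open scoped Classical in (Finset.univ : Finset V).val.map fun v => G.degree v

/-- `D` is the degree sequence of some (finite) tree. -/
def IsTreeDegreeSequence (D : Multiset ℕ) : Prop :=
  ∃ (n : ℕ) (T : SimpleGraph (Fin n)), T.IsTree ∧ degreeSequence T = D

/-- The number of subtrees of a tree, a subtree being a (nonempty) connected induced subgraph. -/
noncomputable def numSubtrees {V : Type*} (G : SimpleGraph V) : ℕ :=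
  {S : Set V | (G.induce S).Connected}.ncard

namespace GreedyTree

/-- The `k`-th largest entry of `D`, counting from `k = 0` (and `0` if `D` has at most `k`
entries). In the greedy algorithm the `k`-th vertex to be labelled receives this degree: each
newly labelled vertex gets the largest degree that is still available. -/
def deg (D : Multiset ℕ) (k : ℕ) : ℕ :=
  (D.sort (· ≥ ·)).getD k 0

/-- The number of neighbours that vertex `k` still has to be given when its turn comes: all of
them for the root `0`, all but its parent for every other vertex. -/
def numChildren (D : Multiset ℕ) (k : ℕ) : ℕ :=
  if k = 0 then deg D k else deg D k - 1

/-- The first label that is unused when the turn of vertex `i` comes: the root has been labelled,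
and so have the children of all vertices `k < i`. -/
def firstChild (D : Multiset ℕ) (i : ℕ) : ℕ :=
  1 + ∑ k ∈ Finset.range i, numChildren D k

/-- The children of vertex `i` are the next `numChildren D i` unused labels. -/
def IsChild (D : Multiset ℕ) (i j : ℕ) : Prop :=
  firstChild D i ≤ j ∧ j < firstChild D i + numChildren D i

end GreedyTree

/-- The greedy tree with degree sequence `D`. The vertices `0, 1, 2, …` are numbered in the order
in which the greedy algorithm labels them; vertex `0` is the root and vertex `k` has the `k`-th
largest degree. The vertices take turns in the order in which they were labelled, which is an order
of non-increasing degree, and each one in its turn is joined to as many new vertices as its degree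
still requires. -/
def greedyTree (D : Multiset ℕ) : SimpleGraph (Fin D.card) :=
  SimpleGraph.fromRel fun i j => GreedyTree.IsChild D i j

/-! Let f(X) be the number of connected vertex sets containing X (`connCount`). By finiteness some
tree T on the given vertices has the most subtrees for its degree sequence. It is enough that every
such T is isomorphic to the greedy tree: existence, maximality and uniqueness then follow together.

Two exchanges force the shape of T. Shifting branches between two vertices until their degrees are
interchanged would gain subtrees unless the vertex of larger degree has strictly larger f
(`connCount_lt_of_deg_lt`). Swapping the branches at the ends of a path a b … c d shows that f(b) <
f(c) forces f(a) < f(d), and likewise for equality (`swap_branches`).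

Root T where f is largest. The second exchange shows inductively that f does not increase with
height, nor within a level along the order of the parents. Hence in breadth-first order, with
siblings sorted by f, both f and (by the first exchange) the degree are non-increasing. A tree
numbered in this way is determined by its degrees. -/

namespace SimpleGraph

/-! ### Counting connected sets when an edge is added -/

variable {V : Type*}

/-- The number of subsets containing `X` that induce a connected subgraph. -/
noncomputable def connCount (G : SimpleGraph V) (X : Set V) : ℕ :=
  {S : Set V | X ⊆ S ∧ (G.induce S).Connected}.ncard

theorem connCount_empty (G : SimpleGraph V) : G.connCount ∅ = numSubtrees G := by
  simp [connCount, numSubtrees]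

theorem Reachable.of_induce {G : SimpleGraph V} {S : Set V} {x y : S}
    (h : (G.induce S).Reachable x y) : G.Reachable x y :=
  h.map (Embedding.induce S).toHom

theorem connCount_mono [Finite V] (G : SimpleGraph V) {X Y : Set V} (h : X ⊆ Y) :
    G.connCount Y ≤ G.connCount X :=
  Set.ncard_le_ncard (fun _ hS => ⟨h.trans hS.1, hS.2⟩) (Set.toFinite _)

theorem connected_induce_singleton (G : SimpleGraph V) (v : V) :
    (G.induce {v}).Connected := by
  have : Nonempty ({v} : Set V) := ⟨⟨v, rfl⟩⟩
  exact ⟨fun x y => by rw [Subsingleton.elim x y]⟩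

theorem connCount_pos [Finite V] (G : SimpleGraph V) (v : V) : 0 < G.connCount {v} :=
  (Set.ncard_pos (Set.toFinite _)).2 ⟨{v}, subset_rfl, G.connected_induce_singleton v⟩

theorem connCount_pair_lt [Finite V] (G : SimpleGraph V) {u v : V} (h : u ≠ v) :
    G.connCount {u, v} < G.connCount {u} := by
  refine Set.ncard_lt_ncard ⟨fun S hS => ⟨fun x hx => hS.1 (by simp_all), hS.2⟩, fun H => ?_⟩
    (Set.toFinite _)
  have := (@H {u} ⟨subset_rfl, G.connected_induce_singleton u⟩).1 (show v ∈ ({u, v} : Set V) by simp)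
  exact h (by simpa using this.symm)

theorem connCount_pair_eq_zero (G : SimpleGraph V) {u v : V} (h : ¬ G.Reachable u v) :
    G.connCount {u, v} = 0 := by
  have : {S : Set V | {u, v} ⊆ S ∧ (G.induce S).Connected} = ∅ := by
    refine Set.eq_empty_of_forall_notMem fun S hS => h ?_
    exact (hS.2.preconnected ⟨u, hS.1 (by simp)⟩ ⟨v, hS.1 (by simp)⟩).of_induce
  rw [connCount, this, Set.ncard_empty]

theorem induce_sup_edge_of_not_subset (G : SimpleGraph V) {u v : V} {S : Set V}
    (h : ¬ (u ∈ S ∧ v ∈ S)) : (G ⊔ edge u v).induce S = G.induce S := by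
  ext ⟨x, hx⟩ ⟨y, hy⟩
  simp only [comap_adj, Function.Embedding.subtype_apply, sup_adj, edge_adj]
  grind

/-- In a connected set of `G + uv`, the part lying in the component of `u` in `G` is connected. -/
theorem connected_induce_inter_component {G : SimpleGraph V} {u v : V} (h : ¬ G.Reachable u v)
    {S : Set V} (hu : u ∈ S) (hv : v ∈ S) (hS : ((G ⊔ edge u v).induce S).Connected) :
    (G.induce {w ∈ S | G.Reachable u w}).Connected ∧
      (G.induce {w ∈ S | G.Reachable v w}).Connected ∧
      ∀ w ∈ S, G.Reachable u w ∨ G.Reachable v w := by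
  set A : Set V := {w ∈ S | G.Reachable u w}
  set B : Set V := {w ∈ S | G.Reachable v w}
  -- Induction along a walk in `S` from `u`: a step along the new edge ends at `u` or `v`, where the
  -- claims are trivial, and any other step stays in its component.
  have key : ∀ w : S, (G.Reachable u w ∨ G.Reachable v w) ∧
      (∀ hw : (w : V) ∈ A, (G.induce A).Reachable ⟨u, hu, .rfl⟩ ⟨w, hw⟩) ∧
      (∀ hw : (w : V) ∈ B, (G.induce B).Reachable ⟨v, hv, .rfl⟩ ⟨w, hw⟩) := by
    intro w
    have hr := hS.preconnected ⟨u, hu⟩ w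
    rw [reachable_iff_reflTransGen] at hr
    induction hr with
    | refl =>
      exact ⟨.inl .rfl, fun _ => .rfl, fun hw => absurd hw.2.symm h⟩
    | @tail x y _ hxy ih =>
      simp only [comap_adj, Function.Embedding.subtype_apply, sup_adj, edge_adj] at hxy
      rcases hxy with hxy | ⟨⟨hx, hy⟩ | ⟨hx, hy⟩, -⟩
      · refine ⟨ih.1.imp (·.trans hxy.reachable) (·.trans hxy.reachable), fun hw => ?_, fun hw => ?_⟩
        · have hx : (x : V) ∈ A := ⟨x.2, hw.2.trans hxy.symm.reachable⟩
          exact (ih.2.1 hx).trans (Adj.reachable (by simpa using hxy))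
        · have hx : (x : V) ∈ B := ⟨x.2, hw.2.trans hxy.symm.reachable⟩
          exact (ih.2.2 hx).trans (Adj.reachable (by simpa using hxy))
      · obtain ⟨y, hy'⟩ := y
        obtain rfl : y = v := hy
        exact ⟨.inr .rfl, fun hw => absurd hw.2 h, fun _ => .rfl⟩
      · obtain ⟨y, hy'⟩ := y
        obtain rfl : y = u := hy
        exact ⟨.inl .rfl, fun _ => .rfl, fun hw => absurd hw.2.symm h⟩
  refine ⟨?_, ?_, fun w hw => (key ⟨w, hw⟩).1⟩
  · have : Nonempty A := ⟨⟨u, hu, .rfl⟩⟩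
    exact ⟨fun x y => ((key ⟨x, x.2.1⟩).2.1 x.2).symm.trans ((key ⟨y, y.2.1⟩).2.1 y.2)⟩
  · have : Nonempty B := ⟨⟨v, hv, .rfl⟩⟩
    exact ⟨fun x y => ((key ⟨x, x.2.1⟩).2.2 x.2).symm.trans ((key ⟨y, y.2.1⟩).2.2 y.2)⟩

/-- A connected set of the larger graph is connected in `G` or splits uniquely at the new edge into
a piece through `u` and a piece through `v`; `hX` puts all of `X` in the first piece. -/
theorem connCount_sup_edge [Finite V] (G : SimpleGraph V) {u v : V} (h : ¬ G.Reachable u v)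
    {X : Set V} (hX : ∀ x ∈ X, ¬ G.Reachable v x) :
    (G ⊔ edge u v).connCount X =
      G.connCount X + G.connCount (insert u X) * G.connCount {v} := by
  have huv : u ≠ v := fun e => h (e ▸ .rfl)
  set A : Set (Set V) := {S | insert u X ⊆ S ∧ (G.induce S).Connected}
  set B : Set (Set V) := {S | {v} ⊆ S ∧ (G.induce S).Connected}
  have hA : ∀ S ∈ A, ∀ w ∈ S, G.Reachable u w := fun S hS w hw =>
    (hS.2.preconnected ⟨u, hS.1 (Set.mem_insert _ _)⟩ ⟨w, hw⟩).of_induce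
  have hB : ∀ S ∈ B, ∀ w ∈ S, G.Reachable v w := fun S hS w hw =>
    (hS.2.preconnected ⟨v, hS.1 rfl⟩ ⟨w, hw⟩).of_induce
  have hAB : ∀ P ∈ A ×ˢ B, {w ∈ P.1 ∪ P.2 | G.Reachable u w} = P.1 ∧
      {w ∈ P.1 ∪ P.2 | G.Reachable v w} = P.2 := by
    rintro ⟨S, R⟩ ⟨hS, hR⟩
    refine ⟨Set.ext fun w => ⟨?_, fun hw => ⟨.inl hw, hA S hS w hw⟩⟩,
      Set.ext fun w => ⟨?_, fun hw => ⟨.inr hw, hB R hR w hw⟩⟩⟩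
    · rintro ⟨hw | hw, hr⟩
      exacts [hw, (h (hr.trans (hB R hR w hw).symm)).elim]
    · rintro ⟨hw | hw, hr⟩
      exacts [(h ((hA S hS w hw).trans hr.symm)).elim, hw]
  have hsplit : {S : Set V | X ⊆ S ∧ ((G ⊔ edge u v).induce S).Connected} =
      {S : Set V | X ⊆ S ∧ (G.induce S).Connected} ∪ (fun P => P.1 ∪ P.2) '' (A ×ˢ B) := by
    ext S
    simp only [Set.mem_ofPred_eq, Set.mem_union, Set.mem_image]
    constructor
    · rintro ⟨hXS, hS⟩
      by_cases hm : u ∈ S ∧ v ∈ S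
      · right
        obtain ⟨h1, h2, h3⟩ := connected_induce_inter_component h hm.1 hm.2 hS
        refine ⟨({w ∈ S | G.Reachable u w}, {w ∈ S | G.Reachable v w}), ⟨⟨Set.insert_subset ⟨hm.1, .rfl⟩ fun x hx => ⟨hXS hx, ?_⟩, h1⟩,
          Set.singleton_subset_iff.2 ⟨hm.2, .rfl⟩, h2⟩, ?_⟩
        · exact (h3 x (hXS hx)).resolve_right (hX x hx)
        · ext w
          simp only [Set.mem_union, Set.mem_ofPred_eq]
          exact ⟨fun hw => hw.elim (·.1) (·.1), fun hw => (h3 w hw).imp (⟨hw, ·⟩) (⟨hw, ·⟩)⟩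
      · rw [induce_sup_edge_of_not_subset G hm] at hS
        exact .inl ⟨hXS, hS⟩
    · rintro (⟨hXS, hS⟩ | ⟨⟨S, R⟩, ⟨hS, hR⟩, rfl⟩)
      · exact ⟨hXS, hS.mono (comap_monotone _ le_sup_left)⟩
      · refine ⟨((Set.subset_insert _ _).trans hS.1).trans Set.subset_union_left, ?_⟩
        refine connected_induce_union (v := u) (w := v)
          (hS.2.mono (comap_monotone _ le_sup_left)).preconnected
          (hR.2.mono (comap_monotone _ le_sup_left)).preconnected
          (hS.1 (Set.mem_insert _ _)) (hR.1 rfl) ?_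
        simp [edge_adj, huv]
  have hdisj : Disjoint {S : Set V | X ⊆ S ∧ (G.induce S).Connected}
      ((fun P => P.1 ∪ P.2) '' (A ×ˢ B)) := by
    rw [Set.disjoint_left]
    rintro _ ⟨-, hc⟩ ⟨⟨S, R⟩, ⟨hS, hR⟩, rfl⟩
    exact h (hc.preconnected ⟨u, .inl (hS.1 (Set.mem_insert _ _))⟩ ⟨v, .inr (hR.1 rfl)⟩).of_induce
  have hinj : Set.InjOn (fun P : Set V × Set V => P.1 ∪ P.2) (A ×ˢ B) := by
    intro P hP Q hQ hPQ
    have h1 := hAB P hP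
    have h2 := hAB Q hQ
    simp only at hPQ
    rw [hPQ] at h1
    exact Prod.ext (h1.1.symm.trans h2.1) (h1.2.symm.trans h2.2)
  rw [connCount, hsplit, Set.ncard_union_eq hdisj (Set.toFinite _) (Set.toFinite _),
    hinj.ncard_image, Set.ncard_prod]
  rfl

theorem connCount_pair_comm (G : SimpleGraph V) (u v : V) :
    G.connCount {u, v} = G.connCount {v, u} := by rw [Set.pair_comm]

/-- Counting after joining two further components, at `a` and `d`, to the component of `b`
and `c`. -/
theorem connCount_sup_two_edges [Finite V] {H : SimpleGraph V} {a b c d : V}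
    (hbc : H.Reachable b c) (hab : ¬ H.Reachable a b) (hdb : ¬ H.Reachable d b)
    (had : ¬ H.Reachable a d) :
    (H ⊔ edge c d ⊔ edge b a).connCount ∅ = H.connCount ∅ + H.connCount {c} * H.connCount {d} +
      (H.connCount {b} + H.connCount {b, c} * H.connCount {d}) * H.connCount {a} ∧
    (H ⊔ edge c d ⊔ edge b a).connCount {b} =
      (H.connCount {b} + H.connCount {b, c} * H.connCount {d}) * (1 + H.connCount {a}) ∧
    (H ⊔ edge c d ⊔ edge b a).connCount {a} =
      H.connCount {a} * (1 + H.connCount {b} + H.connCount {b, c} * H.connCount {d}) := by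
  have hcd : ¬ H.Reachable c d := fun h => hdb (hbc.trans h).symm
  have hba : ¬ (H ⊔ edge c d).Reachable b a := by
    intro h
    have hr : ∀ x, (H ⊔ edge c d).Reachable a x → H.Reachable a x := by
      intro x hx
      rw [reachable_iff_reflTransGen] at hx
      induction hx with
      | refl => rfl
      | tail _ hxy ih =>
        rw [sup_adj, edge_adj] at hxy
        rcases hxy with hxy | ⟨⟨rfl, rfl⟩ | ⟨rfl, rfl⟩, -⟩
        · exact ih.trans hxy.reachable
        · exact (hab (ih.trans hbc.symm)).elim
        · exact (had ih).elim
    exact hab (hr b h.symm)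
  have e1 := connCount_sup_edge H hcd (X := ∅) (by simp)
  have e2 := connCount_sup_edge H hcd (X := {b}) (by simpa using hdb)
  have e3 := connCount_sup_edge H hcd (X := {a}) (by simpa [reachable_comm] using had)
  have f1 := connCount_sup_edge _ hba (X := ∅) (by simp)
  have f2 := connCount_sup_edge _ hba (X := {b}) (by simpa [reachable_comm] using hba)
  have f3 := connCount_sup_edge _ (mt Reachable.symm hba) (X := {a}) (by simpa using hba)
  have hac : H.connCount {c, a} = 0 :=
    H.connCount_pair_eq_zero fun h => hab (hbc.trans h).symm
  rw [edge_comm a b] at f3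
  rw [connCount_pair_comm] at e2
  simp only [insert_empty_eq, Set.insert_eq_of_mem, Set.mem_singleton_iff] at e1 e2 e3 f1 f2 f3
  rw [f1, f2, f3, e1, e2, e3, hac]
  refine ⟨by ring, by ring, by ring⟩

/-! ### Degrees and tree edges -/

/-- The number of neighbours of a vertex. -/
noncomputable def deg (G : SimpleGraph V) (v : V) : ℕ := (G.neighborSet v).ncard

open scoped Classical in
theorem deg_sup_edge [Finite V] {G : SimpleGraph V} {u v : V} (huv : u ≠ v) (h : ¬ G.Adj u v)
    (w : V) : (G ⊔ edge u v).deg w =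
      G.deg w + ((if w = u then 1 else 0) + (if w = v then 1 else 0)) := by
  by_cases hu : w = u
  · subst hu
    have : (G ⊔ edge w v).neighborSet w = insert v (G.neighborSet w) := by
      ext x; simp [edge_adj]; grind
    rw [deg, this, Set.ncard_insert_of_notMem (by simpa using h)]
    simp [deg, huv]
  by_cases hv : w = v
  · subst hv
    have : (G ⊔ edge u w).neighborSet w = insert u (G.neighborSet w) := by
      ext x; simp [edge_adj]; grind
    rw [deg, this, Set.ncard_insert_of_notMem (by simpa [adj_comm] using h)]
    simp [deg, hu]
  have : (G ⊔ edge u v).neighborSet w = G.neighborSet w := by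
    ext x; simp [edge_adj, hu, hv]
  simp [deg, this, hu, hv]

theorem degreeSequence_eq_map_deg [Fintype V] (G : SimpleGraph V) :
    degreeSequence G = (Finset.univ : Finset V).val.map G.deg := by
  classical
  refine Multiset.map_congr rfl fun v _ => ?_
  rw [deg, Set.ncard_eq_toFinset_card', ← card_neighborFinset_eq_degree]
  congr!

theorem IsTree.deg_pos [Finite V] {T : SimpleGraph V} (hT : T.IsTree) {u v : V} (h : u ≠ v) :
    0 < T.deg u := by
  have : Nontrivial V := ⟨u, v, h⟩
  obtain ⟨w, hw⟩ := hT.connected.preconnected.exists_adj_of_nontrivial u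
  exact (Set.ncard_pos (Set.toFinite _)).2 ⟨w, hw⟩

theorem Reachable.of_forall_adj {G G' : SimpleGraph V} (h : ∀ x y, G.Adj x y → G'.Reachable x y)
    {x y : V} (hxy : G.Reachable x y) : G'.Reachable x y := by
  rw [reachable_iff_reflTransGen] at hxy
  induction hxy with
  | refl => rfl
  | tail _ hxy ih => exact ih.trans (h _ _ hxy)

theorem sup_edge_adj_self (G : SimpleGraph V) {u v : V} (h : u ≠ v) : (G ⊔ edge u v).Adj u v := by
  simp [edge_adj, h]

theorem deleteEdges_sup_edge {G : SimpleGraph V} {u v : V} (h : G.Adj u v) :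
    G.deleteEdges {s(u, v)} ⊔ edge u v = G := by
  ext x y
  simp only [sup_adj, deleteEdges_adj, edge_adj, Set.mem_singleton_iff, Sym2.eq_iff]
  have := h.symm
  have := h.ne
  grind

theorem IsAcyclic.not_reachable_deleteEdges {G : SimpleGraph V} (hG : G.IsAcyclic) {u v : V}
    (h : G.Adj u v) : ¬ (G.deleteEdges {s(u, v)}).Reachable u v :=
  isBridge_iff.1 (isAcyclic_iff_forall_adj_isBridge.1 hG h)

/-! ### Exchanges of branches in optimal trees -/

/-- Moving one branch from `u` to a vertex `v` that lies in more subtrees. -/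
theorem IsTree.exists_move_branch [Finite V] {T : SimpleGraph V} (hT : T.IsTree) {u v : V}
    (huv : u ≠ v) (hd : 2 ≤ T.deg u) (hf : T.connCount {u} ≤ T.connCount {v}) :
    ∃ T' : SimpleGraph V, T'.IsTree ∧ T.connCount ∅ < T'.connCount ∅ ∧
      T'.connCount {u} ≤ T'.connCount {v} ∧ T'.deg u + 1 = T.deg u ∧ T'.deg v = T.deg v + 1 ∧
      ∀ w, w ≠ u → w ≠ v → T'.deg w = T.deg w := by
  classical
  -- A neighbour of `u` off the path to `v` exists because `u` has two neighbours; cutting there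
  -- keeps `u` and `v` together.
  obtain ⟨s, hus, hr⟩ : ∃ s, T.Adj u s ∧ (T.deleteEdges {s(u, s)}).Reachable u v := by
    obtain ⟨p, hp⟩ := (hT.connected.preconnected u v).exists_isPath
    obtain ⟨s, hs, hne⟩ : ∃ s ∈ T.neighborSet u, s ≠ p.snd :=
      Set.exists_ne_of_one_lt_ncard (by exact hd) p.snd
    have : s ∉ p.support := fun h => hne (hT.isAcyclic.eq_snd_of_adj_start hp hs h)
    exact ⟨s, hs, reachable_deleteEdges_iff_exists_walk.2
      ⟨p, fun h => this (p.snd_mem_support_of_mem_edges h)⟩⟩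
  have hns := hT.isAcyclic.not_reachable_deleteEdges hus
  have hTe := deleteEdges_sup_edge hus
  have hH : (T.deleteEdges {s(u, s)}).IsAcyclic := hT.isAcyclic.anti (deleteEdges_le _)
  set H := T.deleteEdges {s(u, s)}
  have hvs : ¬ H.Reachable v s := fun h => hns (hr.trans h)
  have nus : u ≠ s := hus.ne
  have nvs : v ≠ s := fun h => hvs (h ▸ .rfl)
  have du := fun w => deg_sup_edge nus (mt Adj.reachable hns) w
  have dv := fun w => deg_sup_edge nvs (mt Adj.reachable hvs) w
  have u1 := connCount_sup_edge H hns (X := ∅) (by simp)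
  have u2 := connCount_sup_edge H hns (X := {u}) (by simpa [reachable_comm] using hns)
  have u3 := connCount_sup_edge H hns (X := {v}) (by simpa [reachable_comm] using hvs)
  have v1 := connCount_sup_edge H hvs (X := ∅) (by simp)
  have v2 := connCount_sup_edge H hvs (X := {u}) (by simpa [reachable_comm] using hns)
  have v3 := connCount_sup_edge H hvs (X := {v}) (by simpa [reachable_comm] using hvs)
  rw [H.connCount_pair_comm v u] at v2
  simp only [insert_empty_eq, Set.insert_eq_of_mem, Set.mem_singleton_iff] at u1 u2 u3 v1 v2 v3
  rw [hTe] at du u1 u2 u3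
  have hlt := H.connCount_pair_lt huv
  have hpos := H.connCount_pos s
  rw [u2, u3] at hf
  -- With f counted in `H`, `hf` says f(u)(1 + f(s)) ≤ f(v) + f(u,v) f(s), while f(u,v) < f(u).
  have hlt' : H.connCount {u} < H.connCount {v} := by
    by_contra! hle
    nlinarith
  have := hT.connected.nonempty
  refine ⟨H ⊔ edge v s, ⟨⟨fun x y => ?_⟩, hH.sup_edge_of_not_reachable hvs⟩, ?_, ?_, ?_, ?_, ?_⟩
  · refine (hT.connected.preconnected x y).of_forall_adj fun x y hxy => ?_
    rw [← hTe, sup_adj, edge_adj] at hxy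
    have hm : H ≤ H ⊔ edge v s := le_sup_left
    have h1 : (H ⊔ edge v s).Reachable u s :=
      (hr.mono hm).trans (sup_edge_adj_self H nvs).reachable
    rcases hxy with hxy | ⟨⟨rfl, rfl⟩ | ⟨rfl, rfl⟩, -⟩
    exacts [hxy.reachable.mono hm, h1, h1.symm]
  · rw [u1, v1]
    nlinarith
  · rw [v2, v3]
    nlinarith
  · rw [du, dv]; simp [huv]; ring
  · rw [du, dv]; simp [huv.symm, nvs]
  · intro w hwu hwv
    rw [du, dv]; simp [hwu, hwv]

/-- The comparison of `u` with `v` survives each move, so moves can be iterated; there are `k + 1`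
of them, which makes the gain strict. -/
theorem IsTree.exists_move_branches [Finite V] {T : SimpleGraph V} (hT : T.IsTree) {u v : V}
    (huv : u ≠ v) (hf : T.connCount {u} ≤ T.connCount {v}) (k : ℕ) (hd : k + 2 ≤ T.deg u) :
    ∃ T' : SimpleGraph V, T'.IsTree ∧ T.connCount ∅ < T'.connCount ∅ ∧
      T'.connCount {u} ≤ T'.connCount {v} ∧ T'.deg u + (k + 1) = T.deg u ∧
      T'.deg v = T.deg v + (k + 1) ∧ ∀ w, w ≠ u → w ≠ v → T'.deg w = T.deg w := by
  induction k with
  | zero => exact hT.exists_move_branch huv hd hf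
  | succ k ih =>
    obtain ⟨T₁, h1, h2, h3, h4, h5, h6⟩ := ih (by omega)
    obtain ⟨T₂, g1, g2, g3, g4, g5, g6⟩ := h1.exists_move_branch huv (by omega) h3
    exact ⟨T₂, g1, h2.trans g2, g3, by omega, by omega,
      fun w hu hv => (g6 w hu hv).trans (h6 w hu hv)⟩

/-- A tree with the largest number of subtrees among all trees on the same vertices that have
the same degree sequence. -/
def IsSubtreeOptimal [Fintype V] (T : SimpleGraph V) : Prop :=
  T.IsTree ∧ ∀ T' : SimpleGraph V, T'.IsTree → degreeSequence T' = degreeSequence T →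
    numSubtrees T' ≤ numSubtrees T

theorem IsSubtreeOptimal.connCount_lt_of_deg_lt [Fintype V] {T : SimpleGraph V}
    (hT : T.IsSubtreeOptimal) {u v : V} (h : T.deg v < T.deg u) :
    T.connCount {v} < T.connCount {u} := by
  classical
  by_contra! hf
  have huv : u ≠ v := by rintro rfl; exact h.false
  have hv := hT.1.deg_pos huv.symm
  -- Moving `T.deg u - T.deg v` branches interchanges the two degrees; `u` has enough branches
  -- because `T.deg v` is positive.
  obtain ⟨T', h1, h2, -, h4, h5, h6⟩ :=
    hT.1.exists_move_branches huv hf (T.deg u - T.deg v - 1) (by omega)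
  refine (hT.2 T' h1 ?_).not_gt (by simpa [connCount_empty] using h2)
  rw [degreeSequence_eq_map_deg, degreeSequence_eq_map_deg]
  have hperm : T'.deg = T.deg ∘ Equiv.swap u v := by
    ext w
    rcases eq_or_ne w u with rfl | hwu
    · simp; omega
    rcases eq_or_ne w v with rfl | hwv
    · simp; omega
    simp [Equiv.swap_apply_of_ne_of_ne hwu hwv, h6 w hwu hwv]
  rw [hperm, ← Multiset.map_map]
  congr 1
  exact congrArg Finset.val (Finset.map_univ_equiv (Equiv.swap u v))

/-- In the forest without both edges let x, y, z count the connected sets with `b` but not `c`, with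
`c` but not `b`, with both, and α, δ those through `a`, `d`. Optimality against the swapped tree
reads (x - y)(δ - α) ≤ 0. In `T`, f(b) - f(c) = x(1 + α) - y(1 + δ) and f(a) - f(d) = α(1 + z + x) -
δ(1 + z + y). -/
theorem IsSubtreeOptimal.swap_branches [Fintype V] {T : SimpleGraph V}
    (hT : T.IsSubtreeOptimal) {a b c d : V} (hab : T.Adj a b) (hcd : T.Adj c d) (hbc : b ≠ c)
    (hr : (T.deleteEdges {s(a, b), s(c, d)}).Reachable b c) :
    (T.connCount {b} < T.connCount {c} → T.connCount {a} < T.connCount {d}) ∧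
      (T.connCount {b} = T.connCount {c} → T.connCount {a} = T.connCount {d}) := by
  classical
  have hTa := hT.1.isAcyclic
  have hH : (T.deleteEdges {s(a, b), s(c, d)}).IsAcyclic := hTa.anti (deleteEdges_le _)
  have l1 : T.deleteEdges {s(a, b), s(c, d)} ≤ T.deleteEdges {s(a, b)} :=
    deleteEdges_anti (by simp)
  have l2 : T.deleteEdges {s(a, b), s(c, d)} ≤ T.deleteEdges {s(c, d)} :=
    deleteEdges_anti (by simp)
  have nab' := hTa.not_reachable_deleteEdges hab
  have ncd' := hTa.not_reachable_deleteEdges hcd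
  have had' : a ≠ d := by
    rintro rfl
    have : (T.deleteEdges {s(a, b)}).Adj c a := by simp [hcd, hbc.symm, hcd.ne]
    exact nab' (this.symm.reachable.trans (hr.mono l1).symm)
  have hcd1 : (T.deleteEdges {s(a, b)}).Adj c d := by
    simp only [deleteEdges_adj, hcd, Set.mem_singleton_iff, Sym2.eq_iff, true_and]
    rintro (⟨-, h⟩ | ⟨-, h⟩)
    exacts [ncd' (h ▸ (hr.mono l2).symm), had' h.symm]
  have nad : ¬ (T.deleteEdges {s(a, b), s(c, d)}).Reachable a d := fun h =>
    nab' ((h.mono l1).trans (hcd1.symm.reachable.trans (hr.mono l1).symm))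
  have nab : ¬ (T.deleteEdges {s(a, b), s(c, d)}).Reachable a b := fun h => nab' (h.mono l1)
  have ncd : ¬ (T.deleteEdges {s(a, b), s(c, d)}).Reachable c d := fun h => ncd' (h.mono l2)
  have hTe : T.deleteEdges {s(a, b), s(c, d)} ⊔ edge c d ⊔ edge b a = T := by
    ext x y
    simp only [sup_adj, deleteEdges_adj, edge_adj, Set.mem_insert_iff, Set.mem_singleton_iff,
      Sym2.eq_iff]
    have := hab.symm
    have := hcd.symm
    have := hab.ne
    have := hcd.ne
    grind
  set H := T.deleteEdges {s(a, b), s(c, d)}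
  have nac : ¬ H.Reachable a c := fun h => nab (h.trans hr.symm)
  have ndb : ¬ H.Reachable d b := fun h => ncd (h.trans hr).symm
  have ndc : ¬ H.Reachable d c := fun h => ncd h.symm
  have nda : ¬ H.Reachable d a := fun h => nad h.symm
  obtain ⟨e1, e2, e3⟩ := connCount_sup_two_edges hr nab ndb nad
  obtain ⟨f1, f2, f3⟩ := connCount_sup_two_edges hr.symm ndc nac nda
  obtain ⟨g1, -, -⟩ := connCount_sup_two_edges hr.symm nac ndc nad
  have hcomm : H ⊔ edge b a ⊔ edge c d = H ⊔ edge c d ⊔ edge b a := sup_right_comm _ _ _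
  rw [hcomm, hTe] at f1 f2 f3
  rw [hTe] at e1 e2 e3
  have hne : ∀ {x y}, ¬ H.Reachable x y → x ≠ y := fun h e => h (e ▸ .rfl)
  have nab2 : ¬ (H ⊔ edge c d).Adj b a := by
    rw [sup_adj, edge_adj]
    rintro (h | ⟨⟨h, -⟩ | ⟨h, -⟩, -⟩)
    exacts [nab h.symm.reachable, hbc h, hne ndb h.symm]
  have nac2 : ¬ (H ⊔ edge b d).Reachable c a := by
    intro h
    have hr' : ∀ x, (H ⊔ edge b d).Reachable a x → H.Reachable a x := by
      intro x hx
      rw [reachable_iff_reflTransGen] at hx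
      induction hx with
      | refl => rfl
      | tail _ hxy ih =>
        rw [sup_adj, edge_adj] at hxy
        rcases hxy with hxy | ⟨⟨rfl, rfl⟩ | ⟨rfl, rfl⟩, -⟩
        · exact ih.trans hxy.reachable
        · exact (nab ih).elim
        · exact (nad ih).elim
    exact nac (hr' c h.symm)
  have hopt : (H ⊔ edge b d ⊔ edge c a).connCount ∅ ≤ T.connCount ∅ := by
    rw [connCount_empty, connCount_empty]
    have := hT.1.connected.nonempty
    refine hT.2 _ ⟨⟨fun x y => ?_⟩, (hH.sup_edge_of_not_reachable (mt Reachable.symm ndb)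
      ).sup_edge_of_not_reachable nac2⟩ ?_
    · refine (hT.1.connected.preconnected x y).of_forall_adj fun x y hxy => ?_
      rw [← hTe, sup_adj, sup_adj, edge_adj, edge_adj] at hxy
      have hm : H ≤ H ⊔ edge b d ⊔ edge c a := le_sup_left.trans le_sup_left
      have h1 : (H ⊔ edge b d ⊔ edge c a).Reachable c a :=
        (sup_edge_adj_self _ (hne nac).symm).reachable
      have h2 : (H ⊔ edge b d ⊔ edge c a).Reachable b d :=
        (sup_edge_adj_self H (hne ndb).symm).reachable.mono le_sup_left
      have h3 := (hr.mono hm).trans h1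
      have h4 := (hr.symm.mono hm).trans h2
      rcases hxy with (hxy | ⟨⟨rfl, rfl⟩ | ⟨rfl, rfl⟩, -⟩) | ⟨⟨rfl, rfl⟩ | ⟨rfl, rfl⟩, -⟩
      exacts [hxy.reachable.mono hm, h4, h4.symm, h3, h3.symm]
    · rw [degreeSequence_eq_map_deg, degreeSequence_eq_map_deg]
      refine Multiset.map_congr rfl fun w _ => ?_
      conv_rhs => rw [← hTe]
      rw [deg_sup_edge (hne nac).symm (mt Adj.reachable nac2),
        deg_sup_edge (hne ndb).symm fun h => ndb h.symm.reachable,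
        deg_sup_edge (hne nab).symm nab2,
        deg_sup_edge (hne ncd) fun h => ncd h.reachable]
      ring
  rw [g1, e1] at hopt
  rw [e2, f2, e3, f3]
  have hx := H.connCount_pair_lt hbc
  have hy := H.connCount_mono (X := {c}) (Y := {b, c}) (by simp)
  have ha := H.connCount_pos a
  have hd := H.connCount_pos d
  rw [H.connCount_pair_comm c b] at *
  obtain ⟨x, hx'⟩ := Nat.exists_eq_add_of_le hx.le
  obtain ⟨y, hy'⟩ := Nat.exists_eq_add_of_le hy
  rw [hx', hy'] at hopt ⊢
  replace hx : 0 < x := by omega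
  clear hx' hy' hy
  generalize H.connCount {a} = α at *
  generalize H.connCount {d} = δ at *
  generalize H.connCount {b, c} = z at *
  have hopt : x * δ + y * α ≤ y * δ + x * α := by linarith
  clear * - hopt hx ha hd
  -- If α ≠ δ, then x and y are weakly ordered like α and δ, and both differences strictly have that
  -- sign.
  rcases lt_trichotomy α δ with h | rfl | h
  · have hxy : x ≤ y := by
      by_contra! hlt
      nlinarith
    have h1 : x * (1 + α) < y * (1 + δ) := by nlinarith
    have h2 : α * (1 + z + x) < δ * (1 + z + y) := by nlinarith
    constructor <;> intro <;> linarith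
  · constructor
    · intro h
      have hxy : x < y := by
        by_contra! hle
        nlinarith
      nlinarith
    · intro h
      have hxy : x = y := by
        have : x * (1 + α) = y * (1 + α) := by linarith
        exact Nat.eq_of_mul_eq_mul_right (by omega) this
      rw [hxy]
  · have hxy : y ≤ x := by
      by_contra! hlt
      nlinarith
    have h1 : y * (1 + δ) < x * (1 + α) := by nlinarith
    constructor <;> intro <;> linarith

/-! ### Rooted trees and monotonicity of the counts -/

/-- `T` is a tree rooted at `r`, with parent map `par` and height function `h`. -/
structure IsRooting (T : SimpleGraph V) (r : V) (par : V → V) (h : V → ℕ) : Prop where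
  par_root : par r = r
  height_root : h r = 0
  adj : ∀ v, v ≠ r → T.Adj (par v) v
  height : ∀ v, v ≠ r → h v = h (par v) + 1
  eq_of_adj : ∀ u v, T.Adj u v → v ≠ r ∧ par v = u ∨ u ≠ r ∧ par u = v

/-- Geodesics from `r` to `u` and to `w` both extend to paths to `v`, and paths in a tree are
unique. -/
theorem IsTree.eq_of_adj_of_dist {T : SimpleGraph V} (hT : T.IsTree) {r u w v : V}
    (hu : T.Adj u v) (hw : T.Adj w v) (hdu : T.dist r v = T.dist r u + 1)
    (hdw : T.dist r v = T.dist r w + 1) : u = w := by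
  obtain ⟨p, hp, hpl⟩ := (hT.connected r u).exists_path_of_dist
  obtain ⟨q, hq, hql⟩ := (hT.connected r w).exists_path_of_dist
  have hps : v ∉ p.support := by
    classical
    intro hv
    have := dist_le (p.takeUntil v hv)
    have := p.length_takeUntil_le_length hv
    omega
  have hqs : v ∉ q.support := by
    classical
    intro hv
    have := dist_le (q.takeUntil v hv)
    have := q.length_takeUntil_le_length hv
    omega
  have := (hT.existsUnique_path r v).unique (hp.concat hps hu) (hq.concat hqs hw)
  simpa using congrArg Walk.penultimate this

theorem IsTree.exists_isRooting {T : SimpleGraph V} (hT : T.IsTree) (r : V) :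
    ∃ par h, T.IsRooting r par h := by
  classical
  have hex : ∀ v, ∃ u, (v = r → u = r) ∧ (v ≠ r → T.Adj u v ∧ T.dist r v = T.dist r u + 1) := by
    intro v
    by_cases hv : v = r
    · exact ⟨r, by simp [hv]⟩
    obtain ⟨p, -, hpl⟩ := (hT.connected v r).exists_path_of_dist
    cases p with
    | nil => exact (hv rfl).elim
    | @cons _ u _ hvu q =>
      refine ⟨u, fun h => (hv h).elim, fun _ => ⟨hvu.symm, ?_⟩⟩
      have h1 := dist_le q
      rw [Walk.length_cons] at hpl
      have h2 := hT.dist_eq_dist_add_one_of_adj r hvu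
      rw [dist_comm] at h1 hpl
      omega
  choose par hpar using hex
  refine ⟨par, T.dist r, (hpar r).1 rfl, dist_self, fun v hv => ((hpar v).2 hv).1,
    fun v hv => ((hpar v).2 hv).2, fun u v huv => ?_⟩
  rcases hT.dist_eq_dist_add_one_of_adj r huv with h | h
  · have hu : u ≠ r := by rintro rfl; simp at h
    exact .inr ⟨hu, hT.eq_of_adj_of_dist ((hpar u).2 hu).1 huv.symm ((hpar u).2 hu).2 h⟩
  · have hv : v ≠ r := by rintro rfl; simp at h
    exact .inl ⟨hv, hT.eq_of_adj_of_dist ((hpar v).2 hv).1 huv ((hpar v).2 hv).2 h⟩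

namespace IsRooting

variable {T : SimpleGraph V} {r : V} {par : V → V} {h : V → ℕ}

theorem height_par (H : T.IsRooting r par h) (v : V) : h (par v) = h v - 1 := by
  by_cases hv : v = r
  · rw [hv, H.par_root, H.height_root]
  · rw [H.height v hv]; simp

theorem height_iterate (H : T.IsRooting r par h) (k : ℕ) (v : V) :
    h (par^[k] v) = h v - k := by
  induction k with
  | zero => rfl
  | succ k ih => rw [Function.iterate_succ_apply', H.height_par, ih]; omega

theorem eq_root (H : T.IsRooting r par h) {v : V} (hv : h v = 0) : v = r := by
  by_contra hne
  have := H.height v hne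
  omega

theorem iterate_height (H : T.IsRooting r par h) (v : V) : par^[h v] v = r :=
  H.eq_root (by rw [H.height_iterate]; simp)

/-- Each deleted edge ends at `a` or `d`, so a climb avoiding both vertices survives. -/
theorem reachable_iterate (H : T.IsRooting r par h) {a b c d x : V} (k : ℕ)
    (hx : ∀ i ≤ k, par^[i] x ≠ a ∧ par^[i] x ≠ d) :
    (T.deleteEdges {s(a, b), s(c, d)}).Reachable x (par^[k] x) := by
  induction k with
  | zero => rfl
  | succ k ih =>
    refine (ih fun i hi => hx i (hi.trans k.le_succ)).trans ?_
    have h1 := hx k k.le_succ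
    have h2 := hx (k + 1) le_rfl
    rw [Function.iterate_succ_apply'] at h2 ⊢
    by_cases hr : par^[k] x = r
    · rw [hr, H.par_root]
    · refine Adj.reachable ?_
      simp only [deleteEdges_adj, (H.adj _ hr).symm, Set.mem_insert_iff, Set.mem_singleton_iff,
        Sym2.eq_iff]
      grind

end IsRooting

theorem IsSubtreeOptimal.connCount_le_of_le [Fintype V] {T : SimpleGraph V}
    (hT : T.IsSubtreeOptimal) {a b c d : V} (hab : T.Adj a b) (hcd : T.Adj c d) (hbc : b ≠ c)
    (hr : (T.deleteEdges {s(a, b), s(c, d)}).Reachable b c)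
    (hle : T.connCount {c} ≤ T.connCount {b}) : T.connCount {d} ≤ T.connCount {a} := by
  rcases hle.eq_or_lt with he | hlt
  · exact ((hT.swap_branches hab hcd hbc hr).2 he.symm).ge
  · refine ((hT.swap_branches hcd.symm hab.symm hbc.symm ?_).1 hlt).le
    rw [Set.pair_comm, Sym2.eq_swap (a := b), Sym2.eq_swap (a := d)]
    exact hr.symm

namespace IsRooting

variable [Fintype V] {T : SimpleGraph V} {r : V} {par : V → V} {h : V → ℕ}

/-- Induction on the height of `u`. If `u` is not an ancestor of `v`, the comparison passes from the
parents along the path through the root. If it is, f(u) < f(v) would give `v` at least the degree of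
`u`, hence a child w; the swap then yields f(par u) < f(w), against induction. -/
theorem connCount_le_of_height_lt (H : T.IsRooting r par h) (hT : T.IsSubtreeOptimal)
    (hr : ∀ v, T.connCount {v} ≤ T.connCount {r}) {u v : V} (huv : h u < h v) :
    T.connCount {v} ≤ T.connCount {u} := by
  induction hn : h u generalizing u v with
  | zero => rw [H.eq_root hn]; exact hr v
  | succ n ih =>
    have hur : u ≠ r := by rintro rfl; simp [H.height_root] at hn
    have hvr : v ≠ r := by rintro rfl; simp [H.height_root] at huv
    have hu := H.height u hur
    have hv := H.height v hvr
    by_cases hd : ∃ k, par^[k] (par v) = u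
    · obtain ⟨k, hk⟩ := hd
      by_contra! hlt
      have hdeg : T.deg u ≤ T.deg v := by
        by_contra! hlt'
        exact hlt.not_gt (hT.connCount_lt_of_deg_lt hlt')
      have hk' : par (par^[k] v) = u := by
        rw [← Function.iterate_succ_apply' par, Function.iterate_succ_apply, hk]
      have hsr : par^[k] v ≠ r := fun e => hur (by rw [← hk', e, H.par_root])
      have h2 : 1 < T.deg u := by
        refine (Set.one_lt_ncard (Set.toFinite _)).2
          ⟨par u, (H.adj u hur).symm, par^[k] v, ?_, fun e => ?_⟩
        · have := H.adj _ hsr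
          rwa [hk'] at this
        · have := H.height _ hsr
          rw [hk', ← e] at this
          omega
      obtain ⟨w, hw, hwv⟩ : ∃ w ∈ T.neighborSet v, w ≠ par v :=
        Set.exists_ne_of_one_lt_ncard (by exact h2.trans_le hdeg) (par v)
      have hw' : w ≠ r ∧ par w = v :=
        (H.eq_of_adj v w hw).resolve_right fun e => hwv e.2.symm
      have hhw := H.height w hw'.1
      rw [hw'.2] at hhw
      have h3 := (hT.swap_branches (H.adj u hur) hw (fun e => by rw [e] at huv; omega) ?_).1 hlt
      · exact h3.not_ge (ih (by omega) (by omega))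
      · have := H.reachable_iterate (a := par u) (b := u) (c := v) (d := w) (x := v) (k + 1) ?_
        · rw [Function.iterate_succ_apply, hk] at this
          exact this.symm
        · intro i hi
          have h4 := H.height_iterate i v
          have h5 := H.height_iterate k (par v)
          rw [hk] at h5
          exact ⟨fun e => by rw [e] at h4; omega, fun e => by rw [e] at h4; omega⟩
    · refine hT.connCount_le_of_le (H.adj u hur).symm (H.adj v hvr) (fun e => ?_) ?_
        (ih (u := par u) (v := par v) (by omega) (by omega))
      · rw [e] at hu; omega
      · refine .trans (v := r) ?_ (.symm ?_)
        · rw [← H.iterate_height (par u)]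
          refine H.reachable_iterate _ fun i _ => ?_
          have h4 := H.height_iterate i (par u)
          exact ⟨fun e => by rw [e] at h4; omega, fun e => by rw [e] at h4; omega⟩
        · rw [← H.iterate_height (par v)]
          refine H.reachable_iterate _ fun i _ => ?_
          have h4 := H.height_iterate i (par v)
          exact ⟨fun e => hd ⟨i, e⟩, fun e => by rw [e] at h4; omega⟩

theorem connCount_le_of_par_le (H : T.IsRooting r par h) (hT : T.IsSubtreeOptimal) {u v : V}
    (hu : u ≠ r) (hv : v ≠ r) (huv : h u = h v) (hne : par u ≠ par v)
    (hle : T.connCount {par v} ≤ T.connCount {par u}) :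
    T.connCount {v} ≤ T.connCount {u} := by
  have hhu := H.height u hu
  have hhv := H.height v hv
  refine hT.connCount_le_of_le (H.adj u hu).symm (H.adj v hv) hne ?_ hle
  refine .trans (v := r) ?_ (.symm ?_)
  · rw [← H.iterate_height (par u)]
    refine H.reachable_iterate _ fun i _ => ?_
    have h4 := H.height_iterate i (par u)
    exact ⟨fun e => by rw [e] at h4; omega, fun e => by rw [e] at h4; omega⟩
  · rw [← H.iterate_height (par v)]
    refine H.reachable_iterate _ fun i _ => ?_
    have h4 := H.height_iterate i (par v)
    exact ⟨fun e => by rw [e] at h4; omega, fun e => by rw [e] at h4; omega⟩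

end IsRooting

/-! ### Breadth-first numbering of an optimal tree -/

/-- A breadth-first numbering of a rooted tree, in which degrees do not increase. -/
structure IsGreedyNumbering (T : SimpleGraph V) (r : V) (par : V → V) (key : V → ℕ) : Prop where
  injective : Function.Injective key
  root_le : ∀ v, key r ≤ key v
  par_mono : ∀ u v, key u ≤ key v → key (par u) ≤ key (par v)
  par_lt : ∀ v, v ≠ r → key (par v) < key v
  adj_iff : ∀ u v, T.Adj u v ↔ v ≠ r ∧ par v = u ∨ u ≠ r ∧ par u = v
  deg_anti : ∀ u v, key u ≤ key v → T.deg v ≤ T.deg u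

theorem IsSubtreeOptimal.exists_isGreedyNumbering [Fintype V] {T : SimpleGraph V}
    (hT : T.IsSubtreeOptimal) : ∃ r par key, T.IsGreedyNumbering r par key := by
  have := hT.1.connected.nonempty
  obtain ⟨r, hr⟩ := Finite.exists_max fun v => T.connCount {v}
  obtain ⟨par, h, H⟩ := hT.1.exists_isRooting r
  set n := Fintype.card V
  set idx := Fintype.equivFin V
  set F := T.connCount {r}
  -- Orders by decreasing `connCount`; `idx`, being below `n`, breaks ties.
  set loc : V → ℕ := fun v => (F - T.connCount {v}) * n + idx v
  set B := (F + 1) * n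
  have hn : 0 < n := Fintype.card_pos
  have hlocB : ∀ v, loc v < B := by
    intro v
    have h1 := (idx v).2
    have h2 : (F - T.connCount {v}) * n ≤ F * n := Nat.mul_le_mul_right _ (Nat.sub_le _ _)
    simp only [loc, B, add_mul, one_mul]
    omega
  have hB : 0 < B := (Nat.zero_le _).trans_lt (hlocB r)
  have hlocinj : Function.Injective loc := by
    intro u v huv
    have h1 : loc u % n = loc v % n := by rw [huv]
    simp only [loc, Nat.mul_add_mod'] at h1
    rw [Nat.mod_eq_of_lt (idx u).2, Nat.mod_eq_of_lt (idx v).2] at h1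
    exact idx.injective (Fin.ext h1)
  have hlocle : ∀ u v, loc u ≤ loc v → T.connCount {v} ≤ T.connCount {u} := by
    intro u v huv
    by_contra! hlt
    have h1 := hr v
    have h2 := (idx v).2
    have h3 : F - T.connCount {v} + 1 ≤ F - T.connCount {u} := by omega
    have h4 := Nat.mul_le_mul_right n h3
    simp only [loc] at huv
    rw [add_mul, one_mul] at h4
    omega
  -- The base `B` numeral whose digits `1 + loc` are read from the root down to `v`. Digits run from
  -- 1 to `B`, so longer numerals are larger and `par` drops the last digit: numerical order is
  -- breadth-first.
  set key : V → ℕ := fun v => ∑ i ∈ Finset.range (h v), B ^ i * (1 + loc (par^[i] v))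
  have hkr : key r = 0 := by simp [key, H.height_root]
  have hk : ∀ v, v ≠ r → key v = B * key (par v) + loc v + 1 := by
    intro v hv
    simp only [key]
    rw [H.height v hv, Finset.sum_range_succ', Finset.mul_sum]
    simp only [Function.iterate_succ_apply, pow_succ, pow_zero, Function.iterate_zero, id]
    rw [Finset.sum_congr rfl fun i _ => by rw [mul_comm (B ^ i) B, mul_assoc]]
    ring
  have hkp : ∀ v, key (par v) = (key v - 1) / B := by
    intro v
    by_cases hv : v = r
    · rw [hv, H.par_root, hkr]; simp
    · rw [hk v hv, Nat.add_sub_cancel, Nat.mul_add_div hB, Nat.div_eq_of_lt (hlocB v), add_zero]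
  have hmono : ∀ u v, key u ≤ key v → key (par u) ≤ key (par v) := by
    intro u v huv
    rw [hkp, hkp]
    exact Nat.div_le_div_right (Nat.sub_le_sub_right huv 1)
  have hkpos : ∀ v, v ≠ r → 0 < key v := fun v hv => by rw [hk v hv]; omega
  have hinj : Function.Injective key := by
    intro u v huv
    by_cases hu : u = r
    · by_contra hne
      have := hkpos v fun e => hne (hu.trans e.symm)
      rw [← huv, hu, hkr] at this
      exact this.false
    · have hv : v ≠ r := by
        rintro rfl
        have := hkpos u hu
        rw [huv, hkr] at this
        exact this.false
      have h1 : (key u - 1) % B = (key v - 1) % B := by rw [huv]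
      rw [hk u hu, hk v hv, Nat.add_sub_cancel, Nat.add_sub_cancel, Nat.mul_add_mod,
        Nat.mul_add_mod, Nat.mod_eq_of_lt (hlocB u), Nat.mod_eq_of_lt (hlocB v)] at h1
      exact hlocinj h1
  have hheight : ∀ u v, h u < h v → key u < key v := by
    intro u v huv
    induction hm : h u generalizing u v with
    | zero =>
      rw [H.eq_root hm, hkr]
      exact hkpos v (by rintro rfl; simp [H.height_root] at huv)
    | succ m ih =>
      by_contra! hle
      have h1 := H.height_par u
      have h2 := H.height_par v
      exact (ih (par u) (par v) (by omega) (by omega)).not_ge (hmono _ _ hle)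
  have hf : ∀ u v, key u ≤ key v → T.connCount {v} ≤ T.connCount {u} := by
    intro u v huv
    rcases lt_trichotomy (h u) (h v) with hlt | he | hgt
    · exact H.connCount_le_of_height_lt hT hr hlt
    · induction hm : h u generalizing u v with
      | zero => rw [H.eq_root hm]; exact hr v
      | succ m ih =>
        have hu : u ≠ r := by rintro rfl; simp [H.height_root] at hm
        have hv : v ≠ r := by rintro rfl; simp [H.height_root] at he; omega
        have h1 := H.height_par u
        have h2 := H.height_par v
        by_cases hp : par u = par v
        · refine hlocle u v ?_
          rw [hk u hu, hk v hv, hp] at huv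
          omega
        · exact H.connCount_le_of_par_le hT hu hv he hp
            (ih (par u) (par v) (hmono _ _ huv) (by omega) (by omega))
    · exact absurd (hheight v u hgt) huv.not_gt
  refine ⟨r, par, key, hinj, fun v => by rw [hkr]; exact Nat.zero_le _, hmono, fun v hv => ?_,
    fun u v => ⟨H.eq_of_adj u v, ?_⟩, fun u v huv => ?_⟩
  · rw [hk v hv]
    nlinarith
  · rintro (⟨hv, rfl⟩ | ⟨hu, rfl⟩)
    exacts [H.adj v hv, (H.adj u hu).symm]
  · by_contra! hlt
    exact (hT.connCount_lt_of_deg_lt hlt).not_ge (hf u v huv)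

/-! ### Identification with the greedy tree -/

open GreedyTree in
theorem IsGreedyNumbering.nonempty_iso [Fintype V] {T : SimpleGraph V} {r : V} {par : V → V}
    {key : V → ℕ} (H : T.IsGreedyNumbering r par key) {D : Multiset ℕ}
    (hD : degreeSequence T = D) : Nonempty (T ≃g greedyTree D) := by
  classical
  have hcard : Fintype.card V = D.card := by
    rw [← hD, degreeSequence_eq_map_deg, Multiset.card_map]; rfl
  let : LinearOrder V := LinearOrder.lift' key H.injective
  set e : V ≃o Fin D.card := (monoEquivOfFin V hcard).symm
  have hle : ∀ u v, e u ≤ e v ↔ key u ≤ key v := fun u v => e.le_iff_le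
  have hdeg : ∀ v, GreedyTree.deg D (e v) = T.deg v := by
    intro v
    have hs : D.sort (· ≥ ·) = List.ofFn fun i => T.deg (e.symm i) := by
      refine List.Perm.eq_of_pairwise' (r := (· ≥ ·)) (Multiset.pairwise_sort _ _) ?_ ?_
      · rw [List.pairwise_ofFn]
        intro i j hij
        exact H.deg_anti _ _ (e.symm.monotone hij.le)
      · rw [← Multiset.coe_eq_coe, Multiset.sort_eq]
        refine hD.symm.trans ?_
        rw [degreeSequence_eq_map_deg,
          ← congrArg Finset.val (Finset.map_univ_equiv e.symm.toEquiv), Finset.map_val,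
          Multiset.map_map, ← Fin.univ_val_map]
        rfl
    simp [GreedyTree.deg, hs]
  have hr0 : (e r : ℕ) = 0 := by
    have : e r ≤ ⟨0, (Nat.zero_le _).trans_lt (e r).2⟩ := by
      rw [← e.le_symm_apply]
      exact H.root_le _
    exact Nat.le_zero.1 this
  have hr0' : ∀ v, (e v : ℕ) = 0 ↔ v = r := fun v =>
    ⟨fun hv => e.injective (Fin.ext (hv.trans hr0.symm)), fun hv => hv ▸ hr0⟩
  set ch : V → Finset V := fun v => {w | w ≠ r ∧ par w = v}
  have hnum : ∀ v, numChildren D (e v) = (ch v).card := by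
    intro v
    simp only [numChildren, hdeg, hr0']
    rw [deg]
    by_cases hv : v = r
    · have : T.neighborSet v = ch v := by
        ext w; simp [H.adj_iff, ch, hv]
      rw [if_pos hv, this, Set.ncard_coe_finset]
    · have : T.neighborSet v = insert (par v) (ch v : Set V) := by
        ext w; simp [H.adj_iff, ch, hv]; grind
      rw [if_neg hv, this, Set.ncard_insert_of_notMem, Set.ncard_coe_finset, Nat.add_sub_cancel]
      simp only [ch, Finset.coe_filter, Finset.mem_univ, true_and, Set.mem_ofPred_eq, not_and]
      intro hp hpp
      have h1 := H.par_lt _ hp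
      have h2 := H.par_lt v hv
      rw [hpp] at h1
      omega
  -- Apart from the root, these are the vertices labelled before turn `i`. Since `par` is monotone
  -- they form an initial segment, so their number locates the children of vertex `i`.
  set S : ℕ → Finset V := fun i => {w | w ≠ r ∧ (e (par w) : ℕ) < i}
  have hfirst : ∀ i ≤ D.card, firstChild D i = 1 + (S i).card := by
    intro i hi
    induction i with
    | zero => simp [firstChild, S]
    | succ i ih =>
      have hu : S (i + 1) = S i ∪ ch (e.symm ⟨i, hi⟩) := by
        ext w
        simp only [S, ch, Finset.mem_union, Finset.mem_filter, Finset.mem_univ, true_and,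
          Nat.lt_succ_iff_lt_or_eq, ← and_or_left, OrderIso.eq_symm_apply, Fin.ext_iff]
      have hd : Disjoint (S i) (ch (e.symm ⟨i, hi⟩)) := by
        rw [Finset.disjoint_left]
        intro w hw hw'
        simp only [S, ch, Finset.mem_filter, Finset.mem_univ, true_and] at hw hw'
        rw [hw'.2] at hw
        simp at hw
      have := hnum (e.symm ⟨i, hi⟩)
      rw [OrderIso.apply_symm_apply] at this
      rw [hu, Finset.card_union_of_disjoint hd, ← this, ← add_assoc, ← ih (by omega), firstChild,
        firstChild, Finset.sum_range_succ, add_assoc]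
  have hmem : ∀ i w, w ≠ r → ((e w : ℕ) < 1 + (S i).card ↔ (e (par w) : ℕ) < i) := by
    intro i w hw
    have himg := Finset.card_image_of_injective (S i) (f := fun x => (e x : ℕ))
      (Fin.val_injective.comp e.injective)
    have hw0 : (e w : ℕ) ≠ 0 := fun h => hw ((hr0' w).1 h)
    by_cases hin : (e (par w) : ℕ) < i
    · have hsub : Finset.Ioc 0 (e w : ℕ) ⊆ (S i).image fun x => (e x : ℕ) := by
        intro m hm
        rw [Finset.mem_Ioc] at hm
        have hm' : m < D.card := hm.2.trans_lt (e w).2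
        refine Finset.mem_image.2 ⟨e.symm ⟨m, hm'⟩, ?_, by simp⟩
        simp only [S, Finset.mem_filter, Finset.mem_univ, true_and]
        constructor
        · rw [Ne, ← hr0']; simp; omega
        · refine lt_of_le_of_lt ?_ hin
          refine (hle _ _).2 (H.par_mono _ _ ((hle _ _).1 ?_))
          rw [OrderIso.apply_symm_apply]
          exact hm.2
      have := Finset.card_le_card hsub
      rw [himg, Nat.card_Ioc] at this
      simp only [hin, iff_true]
      omega
    · have hsub : (S i).image (fun x => (e x : ℕ)) ⊆ Finset.Ioo 0 (e w : ℕ) := by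
        intro m hm
        obtain ⟨x, hx, rfl⟩ := Finset.mem_image.1 hm
        simp only [S, Finset.mem_filter, Finset.mem_univ, true_and] at hx
        refine Finset.mem_Ioo.2 ⟨Nat.pos_of_ne_zero fun h => hx.1 ((hr0' x).1 h), ?_⟩
        by_contra! hge
        have h1 := (hle _ _).2 (H.par_mono _ _ ((hle w x).1 hge))
        exact hin (lt_of_le_of_lt h1 hx.2)
      have := Finset.card_le_card hsub
      rw [himg, Nat.card_Ioo] at this
      simp only [hin, iff_false]
      omega
  have hchild : ∀ v w, IsChild D (e v) (e w) ↔ w ≠ r ∧ par w = v := by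
    intro v w
    have h1 : firstChild D (e v) + numChildren D (e v) = firstChild D ((e v : ℕ) + 1) := by
      rw [firstChild, firstChild, Finset.sum_range_succ, add_assoc]
    rw [IsChild, h1, hfirst _ (e v).2.le, hfirst _ (e v).2]
    by_cases hw : w = r
    · rw [(hr0' w).2 hw]; simp [hw]
    · rw [← not_lt, hmem _ _ hw, hmem _ _ hw]
      simp only [hw, ne_eq, not_false_eq_true, true_and]
      rw [← e.injective.eq_iff, Fin.ext_iff]
      omega
  refine ⟨⟨e.toEquiv, fun {u v} => ?_⟩⟩
  simp only [greedyTree, fromRel_adj, H.adj_iff]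
  change e u ≠ e v ∧ (IsChild D (e u) (e v) ∨ IsChild D (e v) (e u)) ↔ _
  rw [hchild, hchild, and_iff_right_iff_imp]
  intro h he
  rw [e.injective he] at h
  rcases h with h | h <;> exact absurd (H.par_lt _ h.1) (by rw [h.2]; exact lt_irrefl _)

/-! ### Isomorphism invariance and conclusion -/

theorem numSubtrees_congr {W : Type*} {G : SimpleGraph V} {G' : SimpleGraph W} (e : G ≃g G') :
    numSubtrees G = numSubtrees G' := by
  have : {S : Set W | (G'.induce S).Connected} =
      (e.toEquiv '' ·) '' {S : Set V | (G.induce S).Connected} := by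
    ext S
    have hi : ∀ R : Set V, (G.induce R).Connected ↔ (G'.induce (e.toEquiv '' R)).Connected :=
      fun R => Iso.connected_iff ⟨e.toEquiv.image R, fun {a b} => e.map_adj_iff (v := a) (w := b)⟩
    refine ⟨fun hS => ⟨e.toEquiv ⁻¹' S, ?_, ?_⟩, ?_⟩
    · rw [Set.mem_ofPred_eq, hi, e.toEquiv.image_preimage]
      exact hS
    · exact e.toEquiv.image_preimage S
    · rintro ⟨R, hR, rfl⟩
      exact (hi R).1 hR
  rw [numSubtrees, numSubtrees, this, Set.ncard_image_of_injective _ e.toEquiv.injective.image_injective]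

theorem degreeSequence_congr {W : Type*} [Fintype V] [Fintype W] {G : SimpleGraph V}
    {G' : SimpleGraph W} (e : G ≃g G') : degreeSequence G = degreeSequence G' := by
  have hdeg : ∀ v, G'.deg (e v) = G.deg v := by
    intro v
    have : G'.neighborSet (e v) = e '' G.neighborSet v := by
      ext w
      obtain ⟨w, rfl⟩ := e.surjective w
      simp [e.map_adj_iff]
    rw [deg, this, Set.ncard_image_of_injective _ e.injective, deg]
  rw [degreeSequence_eq_map_deg, degreeSequence_eq_map_deg,
    ← congrArg Finset.val (Finset.map_univ_equiv e.toEquiv), Finset.map_val, Multiset.map_map]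
  exact Multiset.map_congr rfl fun v _ => (hdeg v).symm

theorem IsTree.exists_isSubtreeOptimal [Fintype V] {T : SimpleGraph V} (hT : T.IsTree) :
    ∃ T' : SimpleGraph V, T'.IsSubtreeOptimal ∧ degreeSequence T' = degreeSequence T ∧
      numSubtrees T ≤ numSubtrees T' := by
  obtain ⟨T', ⟨h1, h2⟩, h3⟩ := Set.exists_max_image
    {T' : SimpleGraph V | T'.IsTree ∧ degreeSequence T' = degreeSequence T} numSubtrees
    (Set.toFinite _) ⟨T, hT, rfl⟩
  exact ⟨T', ⟨h1, fun T'' g1 g2 => h3 T'' ⟨g1, g2.trans h2⟩⟩, h2, h3 T ⟨hT, rfl⟩⟩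

theorem IsSubtreeOptimal.nonempty_iso_greedyTree [Fintype V] {T : SimpleGraph V}
    (hT : T.IsSubtreeOptimal) {D : Multiset ℕ} (hD : degreeSequence T = D) :
    Nonempty (T ≃g greedyTree D) := by
  obtain ⟨r, par, key, H⟩ := hT.exists_isGreedyNumbering
  exact H.nonempty_iso hD

end SimpleGraph

open SimpleGraph in
theorem mainTheorem10 (D : Multiset ℕ) (hD : IsTreeDegreeSequence D) :
    ((greedyTree D).IsTree ∧ degreeSequence (greedyTree D) = D) ∧
      ∀ (V : Type*) [Fintype V] (T : SimpleGraph V), T.IsTree → degreeSequence T = D →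
        numSubtrees T ≤ numSubtrees (greedyTree D) ∧
          (numSubtrees T = numSubtrees (greedyTree D) ↔ Nonempty (T ≃g greedyTree D)) := by
  constructor
  · obtain ⟨n, T, hT, hTD⟩ := hD
    obtain ⟨T', h1, h2, -⟩ := hT.exists_isSubtreeOptimal
    obtain ⟨e⟩ := h1.nonempty_iso_greedyTree (h2.trans hTD)
    exact ⟨e.isTree_iff.1 h1.1, (degreeSequence_congr e).symm.trans (h2.trans hTD)⟩
  · intro V _ T hT hTD
    obtain ⟨T', h1, h2, h3⟩ := hT.exists_isSubtreeOptimal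
    obtain ⟨e⟩ := h1.nonempty_iso_greedyTree (h2.trans hTD)
    rw [← numSubtrees_congr e]
    refine ⟨h3, fun h => ?_, fun ⟨e'⟩ => (numSubtrees_congr e').trans (numSubtrees_congr e).symm⟩
    -- Equality makes `T` itself optimal.
    refine IsSubtreeOptimal.nonempty_iso_greedyTree ⟨hT, fun T'' g1 g2 => ?_⟩ hTD
    rw [h]
    exact h1.2 T'' g1 (g2.trans h2.symm)
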